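/- Let $q\in\{2,3\}$ and let $\mathrm{AG}(3,q)$ be the three-dimensional affine space over the field with $q$ elements. A line spread of $\mathrm{AG}(3,q)$ is a set of pairwise disjoint (affine) lines that partitions the point set. A Cameron–Liebler line class of $\mathrm{AG}(3,q)$ is a set $\mathcal L$ of (affine) lines for which there is an integer $x\ge 0$ (its parameter) such that $|\mathcal L\cap\mathcal S|=x$ for every line spread $\mathcal S$ of $\mathrm{AG}(3,q)$. Then a set $\mathcal L$ of lines of $\mathrm{AG}(3,q)$ is a Cameron–Liebler line class if and only if it is one of the following: the empty set; the set of all lines through some point $p$ of $\mathrm{AG}(3,q)$; the complement, in the set of all lines of $\mathrm{AG}(3,q)$, of the set of all lines through some point $p$ of $\mathrm{AG}(3,q)$; the set of all lines of $\mathrm{AG}(3,q)$. -/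

import Mathlib

/-- The point set `K³` of the three-dimensional affine space over `K`; it is `AG(3,q)` when `K` is
the field with `q` elements. -/
abbrev AG3 (K : Type*) : Type _ := Fin 3 → K

namespace AG3

/-- The set of lines: the nonempty affine subspaces whose direction is one-dimensional. -/
def lines (K : Type*) [Field K] : Set (AffineSubspace K (AG3 K)) :=
  {l | (l : Set (AG3 K)).Nonempty ∧ Module.finrank K l.direction = 1}

/-- A partial line spread: a set of pairwise disjoint lines. -/
def IsPartialLineSpread {K : Type*} [Field K] (S : Set (AffineSubspace K (AG3 K))) : Prop :=
  S ⊆ lines K ∧ ∀ l ∈ S, ∀ m ∈ S, l ≠ m → Disjoint (l : Set (AG3 K)) (m : Set (AG3 K))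

/-- A line spread: a partial line spread that partitions the points. -/
def IsLineSpread {K : Type*} [Field K] (S : Set (AffineSubspace K (AG3 K))) : Prop :=
  IsPartialLineSpread S ∧ ∀ p : AG3 K, ∃ l ∈ S, p ∈ l

/-- A Cameron–Liebler line class of parameter `x`: a set of lines that has exactly `x` lines in
common with every line spread. -/
def IsCLLineClassOfParameter {K : Type*} [Field K] (x : ℕ)
    (L : Set (AffineSubspace K (AG3 K))) : Prop :=
  L ⊆ lines K ∧ ∀ S : Set (AffineSubspace K (AG3 K)), IsLineSpread S → (L ∩ S).encard = x

/-- A Cameron–Liebler line class, of some parameter. -/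
def IsCLLineClass {K : Type*} [Field K] (L : Set (AffineSubspace K (AG3 K))) : Prop :=
  ∃ x : ℕ, IsCLLineClassOfParameter x L

/-- The point-star of `p`: all lines through the (affine) point `p`. -/
def pointStar {K : Type*} [Field K] (p : AG3 K) : Set (AffineSubspace K (AG3 K)) :=
  {l | l ∈ lines K ∧ p ∈ l}

/-- The trivial examples: the empty set, a point-star, and their complements in the set of all
lines (the complement of the empty set is the set of all lines). -/
def IsTrivialLineClass {K : Type*} [Field K] (L : Set (AffineSubspace K (AG3 K))) : Prop :=
  L = ∅ ∨ (∃ p : AG3 K, L = pointStar p) ∨ (∃ p : AG3 K, L = lines K \ pointStar p) ∨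
    L = lines K

end AG3

namespace AG3



/-! ### Weights of balanced flag functions -/

section LineFunction

variable {K : Type*} [Field K] [Fintype K]

/-! Replacing one parallel class of a plane by another inside a spread of parallel lines shows that
a class L has equally many lines in all parallel classes of a plane
(`IsCLLineClassOfParameter.isBalanced`). Double counting then yields an integer weight h on the
points, with (q+1)h(p)+x lines of L through p, whose sum over a line is q if the line is in L and 0
otherwise (`IsBalanced.exists_weight`).

Complementation sends x to q²-x, so 2x ≤ q² may be assumed. If h ≥ 0, a point of positive weight has
all its lines in L, hence weight at least q, which leaves weight 0 for every other point: L is empty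
or a point-star (`IsBalanced.eq_zero_or_star`). Since no point lies on a negative number of lines of
L, h ≥ 0 is immediate except when q=3 and x=4, where weight -1 is excluded by a combinatorial
argument (`IsBalanced.weight_nonneg_of_card_eq_three`). -/

/-- An integer function of flags (point, direction vector) that comes from a function on lines and
whose sums over the parallel classes of a plane, and of the space, do not depend on the class. -/
structure IsBalanced (F : AG3 K → AG3 K → ℤ) (x : ℤ) : Prop where
  zero_or_one : ∀ p d, F p d = 0 ∨ F p d = 1
  zero_dir : ∀ p, F p 0 = 0
  shift : ∀ p d (t : K), F (p + t • d) d = F p d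
  scale : ∀ p d (s : K), s ≠ 0 → F p (s • d) = F p d
  plane : ∀ p d e, d ≠ 0 → e ≠ 0 → ∑ t : K, F (p + t • d) e = ∑ t : K, F (p + t • e) d
  space : ∀ d, d ≠ 0 → ∑ p, F p d = Fintype.card K * x

variable {F : AG3 K → AG3 K → ℤ} {x : ℤ}

/-- The plane condition turns the lines meeting the line p+⟨d⟩ into its parallels. For each t ≠ 0
the points p+t•e run over the whole space, while t=0 gives the line itself q³ times. Sums over
direction vectors count each line q-1 times. -/
lemma IsBalanced.sum_degree (hF : IsBalanced F x) (p : AG3 K) {d : AG3 K} (hd : d ≠ 0) :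
    ∑ t : K, ∑ e, F (p + t • d) e =
      Fintype.card K * (Fintype.card K - 1) * ((Fintype.card K + 1) * F p d + x) := by
  classical
  have h1 : ∑ e, ∑ t : K, F (p + t • d) e =
      ∑ e, ((∑ t : K, F (p + t • e) d) - if e = 0 then (Fintype.card K : ℤ) * F p d else 0) := by
    refine Finset.sum_congr rfl fun e _ => ?_
    by_cases he : e = 0
    · simp [he, hF.zero_dir]
    · simp [he, hF.plane p d e hd he]
  have h2 : ∀ t : K, ∑ e, F (p + t • e) d =
      Fintype.card K * x + if t = 0 then (Fintype.card K : ℤ) ^ 3 * F p d - Fintype.card K * x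
        else 0 := by
    intro t
    by_cases ht : t = 0
    · simp [ht]
    · simp only [ht, if_false, add_zero]
      rw [← hF.space d hd]
      exact Fintype.sum_equiv ((MulAction.toPerm (Units.mk0 t ht)).trans (Equiv.addLeft p)) _ _
        (fun e => by simp [Units.smul_def])
  rw [Finset.sum_comm, h1, Finset.sum_sub_distrib, Finset.sum_comm]
  simp only [h2, Finset.sum_add_distrib, Finset.sum_ite_eq', Finset.mem_univ, if_true,
    Finset.sum_const, Finset.card_univ, nsmul_eq_mul]
  ring

/-- The weight of a point: up to normalisation, the preimage of `F` under the incidence map. -/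
lemma IsBalanced.exists_weight (hF : IsBalanced F x) :
    ∃ h : AG3 K → ℤ,
      (∀ p, ∑ e, F p e =
        (Fintype.card K - 1) * ((Fintype.card K + 1) * h p + x)) ∧
      ∀ p d, d ≠ 0 → ∑ t : K, h (p + t • d) = Fintype.card K * F p d := by
  classical
  set q : ℤ := (Fintype.card K : ℤ) with hq
  have hq1 : 1 < q := by rw [hq]; exact_mod_cast Fintype.one_lt_card
  -- Integrality: sum the degrees over a plane on p in two ways, by the parallels to d and by the
  -- pencil at p. The weight is the number of lines of L in the pencil minus the number in the
  -- parallel class.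
  have key : ∀ p, ∃ n : ℤ, ∑ e, F p e = (q - 1) * ((q + 1) * n + x) := by
    intro p
    obtain ⟨d, hd⟩ : ∃ d : AG3 K, d = Pi.single 0 1 := ⟨_, rfl⟩
    obtain ⟨e, he⟩ : ∃ e : AG3 K, e = Pi.single 1 1 := ⟨_, rfl⟩
    have hd0 : d ≠ 0 := by simp [hd]
    have hes : ∀ s : K, e + s • d ≠ 0 := by
      intro s h
      have := congrFun h 1
      simp [hd, he] at this
    refine ⟨F p d + ∑ s : K, F p (e + s • d) - ∑ t : K, F (p + t • e) d, ?_⟩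
    set D : AG3 K → ℤ := fun p => ∑ e, F p e with hD
    have h0 : ∀ p d, d ≠ 0 → ∑ t : K, D (p + t • d) = q * (q - 1) * ((q + 1) * F p d + x) :=
      fun p d hd => hF.sum_degree p hd
    have hplane : ∑ t : K, ∑ s : K, D (p + t • e + s • d) =
        q * (q - 1) * ((q + 1) * (∑ t : K, F (p + t • e) d) + q * x) := by
      simp only [h0 _ d hd0, ← Finset.mul_sum, Finset.sum_add_distrib, Finset.sum_const,
        Finset.card_univ, nsmul_eq_mul, ← hq]
    have hpencil : ∑ s : K, ∑ t : K, D (p + t • (e + s • d)) =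
        q * (q - 1) * ((q + 1) * (∑ s : K, F p (e + s • d)) + q * x) := by
      simp only [h0 _ _ (hes _), ← Finset.mul_sum, Finset.sum_add_distrib, Finset.sum_const,
        Finset.card_univ, nsmul_eq_mul, ← hq]
    -- For t ≠ 0, s ↦ t*s reindexes a row of the pencil as a parallel to d. For t=0 the row is p
    -- repeated q times, and the parallel through p is missing.
    have hrow : ∀ t : K, ∑ s : K, D (p + t • (e + s • d)) =
        (∑ s : K, D (p + t • e + s • d)) +
          if t = 0 then q * D p - ∑ s : K, D (p + s • d) else 0 := by
      intro t
      by_cases ht : t = 0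
      · simp [ht, hq]
      · simp only [ht, if_false, add_zero]
        exact Fintype.sum_equiv (Equiv.mulLeft₀ t ht) _ _
          (fun s => by simp [smul_add, smul_smul, add_assoc])
    rw [Finset.sum_comm] at hpencil
    simp only [hrow, Finset.sum_add_distrib, Finset.sum_ite_eq', Finset.mem_univ, if_true,
      hplane, h0 p d hd0] at hpencil
    have : q * D p = q * ((q - 1) * ((q + 1) * (F p d + ∑ s : K, F p (e + s • d) -
        ∑ t : K, F (p + t • e) d) + x)) := by linear_combination hpencil
    exact mul_left_cancel₀ (by omega) this
  choose h hh using key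
  refine ⟨h, hh, fun p d hd => ?_⟩
  have h1 := hF.sum_degree p hd
  simp only [hh, ← Finset.mul_sum, Finset.sum_add_distrib, Finset.sum_const,
    Finset.card_univ, nsmul_eq_mul, ← hq] at h1
  have h2 : ((q - 1) * (q + 1)) * ∑ t : K, h (p + t • d) = ((q - 1) * (q + 1)) * (q * F p d) := by
    linear_combination h1
  exact mul_left_cancel₀ (by nlinarith) h2

lemma IsBalanced.sum_le (hF : IsBalanced F x) (p : AG3 K) :
    ∑ e, F p e ≤ (Fintype.card K : ℤ) ^ 3 - 1 := by
  classical
  have h1 : ∀ e, F p e ≤ 1 - if e = 0 then 1 else 0 := by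
    intro e
    by_cases he : e = 0
    · simp [he, hF.zero_dir]
    · rcases hF.zero_or_one p e with h | h <;> simp [h, he]
  refine (Finset.sum_le_sum fun e _ => h1 e).trans ?_
  simp

lemma IsBalanced.sum_eq_of_forall (hF : IsBalanced F x) (p : AG3 K)
    (h : ∀ e, e ≠ 0 → F p e = 1) : ∑ e, F p e = (Fintype.card K : ℤ) ^ 3 - 1 := by
  classical
  have h1 : ∀ e, F p e = 1 - if e = 0 then 1 else 0 := by
    intro e
    by_cases he : e = 0
    · simp [he, hF.zero_dir]
    · simp [h e he, he]
  simp [h1]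

lemma IsBalanced.nonneg (hF : IsBalanced F x) (p d : AG3 K) : 0 ≤ F p d := by
  rcases hF.zero_or_one p d with h | h <;> simp [h]

/-- Nonnegative weights only occur for the empty class and for point-stars. -/
lemma IsBalanced.eq_zero_or_star (hF : IsBalanced F x) (hx : x ≤ Fintype.card K + 1)
    {h : AG3 K → ℤ} (hdeg : ∀ p, ∑ e, F p e =
        (Fintype.card K - 1) * ((Fintype.card K + 1) * h p + x))
    (hline : ∀ p d, d ≠ 0 → ∑ t : K, h (p + t • d) = Fintype.card K * F p d)
    (hpos : ∀ p, 0 ≤ h p) :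
    (∀ p d, F p d = 0) ∨ ∃ c, ∀ p d, d ≠ 0 → (F p d = 1 ↔ ∃ t : K, p + t • d = c) := by
  classical
  set q : ℤ := (Fintype.card K : ℤ) with hq
  have hq1 : 1 < q := by rw [hq]; exact_mod_cast Fintype.one_lt_card
  have hF1 : ∀ p d, F p d ≤ 1 := fun p d => by rcases hF.zero_or_one p d with h | h <;> simp [h]
  by_cases hall : ∀ p, h p = 0
  · left
    intro p d
    by_cases hd : d = 0
    · rw [hd, hF.zero_dir]
    · have := hline p d hd
      simp only [hall, Finset.sum_const_zero] at this
      rcases mul_eq_zero.1 this.symm with h | h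
      · omega
      · exact h
  · right
    push Not at hall
    obtain ⟨c, hc⟩ := hall
    have hone : ∀ d, d ≠ 0 → F c d = 1 := by
      intro d hd
      refine (hF.zero_or_one c d).resolve_left fun h0 => ?_
      have h1 := hline c d hd
      rw [h0, mul_zero, Finset.sum_eq_zero_iff_of_nonneg fun t _ => hpos _] at h1
      have := h1 0 (Finset.mem_univ _)
      simp at this
      exact hc this
    -- All lines through c are in L, so (q+1)h(c) = q²+q+1-x ≥ q², which exceeds (q+1)(q-1).
    have hcq : q ≤ h c := by
      have h1 := hF.sum_eq_of_forall c hone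
      rw [hdeg c] at h1
      have h2 : (q + 1) * h c + x = q ^ 2 + q + 1 :=
        mul_left_cancel₀ (show q - 1 ≠ 0 by omega) (by rw [h1]; ring)
      by_contra hlt
      push Not at hlt
      nlinarith
    have hother : ∀ r, r ≠ c → h r = 0 := by
      intro r hr
      have h1 := hline c (r - c) (sub_ne_zero.2 hr)
      have h2 : h c + h r ≤ ∑ t : K, h (c + t • (r - c)) := by
        have := Finset.sum_le_sum_of_subset_of_nonneg (f := fun t : K => h (c + t • (r - c)))
          (Finset.subset_univ ({0, 1} : Finset K)) (fun t _ _ => hpos _)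
        rw [Finset.sum_pair zero_ne_one] at this
        simpa using this
      have := hF1 c (r - c)
      have := hpos r
      nlinarith
    refine ⟨c, fun p d hd => ⟨fun h1 => ?_, ?_⟩⟩
    · by_contra hne
      push Not at hne
      have h2 := hline p d hd
      rw [Finset.sum_eq_zero fun t _ => hother _ (hne t), h1] at h2
      omega
    · rintro ⟨t, rfl⟩
      rw [← hF.shift p d t]
      exact hone d hd

/-! ### Excluding negative weights for q = 3 -/

lemma smul_line_sum_of_card_eq_three (hK : Fintype.card K = 3) (h : AG3 K → ℤ) (p d : AG3 K) :
    ∑ t : K, h (p + t • d) = h p + h (p + d) + h (p - d) := by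
  classical
  have h2 : (2 : K) ≠ 0 := by
    intro h2
    have h3 : (3 : K) = 0 := by
      have := FiniteField.cast_card_eq_zero K
      rw [hK] at this
      exact_mod_cast this
    exact one_ne_zero (α := K) (by linear_combination h3 - h2)
  have hne : (1 : K) ≠ -1 := fun h => h2 (by linear_combination h)
  have hu : (Finset.univ : Finset K) = {0, 1, -1} := by
    symm
    apply Finset.eq_univ_of_card
    rw [hK]
    exact Finset.card_eq_three.2 ⟨0, 1, -1, by simp, by simp, hne, rfl⟩
  rw [hu, Finset.sum_insert (by simp), Finset.sum_pair hne]
  simp [sub_eq_add_neg, add_assoc]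

/-- Over the field with three elements, no weight is negative when the parameter is at most
four. -/
lemma IsBalanced.weight_nonneg_of_card_eq_three (hF : IsBalanced F x) (hK : Fintype.card K = 3)
    (hx : x ≤ 4) {h : AG3 K → ℤ} (hdeg : ∀ p, ∑ e, F p e =
        (Fintype.card K - 1) * ((Fintype.card K + 1) * h p + x))
    (hline : ∀ p d, d ≠ 0 → ∑ t : K, h (p + t • d) = Fintype.card K * F p d) (p : AG3 K) :
    0 ≤ h p := by
  classical
  by_contra hp
  push Not at hp
  have hle := fun p => hF.sum_le p
  simp only [hdeg, hK] at hle
  have hge : ∀ p, 0 ≤ ∑ e, F p e := fun p => Finset.sum_nonneg fun e _ => hF.nonneg p e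
  simp only [hdeg, hK] at hge
  norm_num at hle hge
  have hx4 : x = 4 := by have := hge p; omega
  subst hx4
  have hlo : ∀ p, -1 ≤ h p := fun p => by have := hge p; omega
  have hhi : ∀ p, h p ≤ 2 := fun p => by have := hle p; omega
  have hl : ∀ p d, d ≠ 0 → h p + h (p + d) + h (p - d) = 3 * F p d := by
    intro p d hd
    rw [← smul_line_sum_of_card_eq_three hK, hline p d hd, hK]
    rfl
  have hD : ∀ p, ∑ e, F p e = 8 * h p + 8 := by
    intro p
    rw [hdeg, hK]
    push_cast
    ring
  have hneg0 : ∀ r, h r = -1 → ∀ d, F r d = 0 := by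
    intro r hr d
    have := hD r
    rw [hr] at this
    norm_num at this
    exact (Finset.sum_eq_zero_iff_of_nonneg fun e _ => hF.nonneg r e).1 this d (Finset.mem_univ _)
  have hcardV : (Finset.univ : Finset (AG3 K)).card = 27 := by simp [hK]
  set N : Finset (AG3 K) := Finset.univ.filter fun r => h r = -1 with hN
  -- The 27 vectors, zero included, minus the degree 8h+8.
  have hZ : ∀ r, ((Finset.univ.filter fun d => F r d = 0).card : ℤ) = 19 - 8 * h r := by
    intro r
    have h1 : ∑ e, (1 - F r e) = ((Finset.univ.filter fun d => F r d = 0).card : ℤ) := by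
      rw [Finset.card_filter]
      push_cast
      refine Finset.sum_congr rfl fun e _ => ?_
      rcases hF.zero_or_one r e with h | h <;> simp [h]
    rw [← h1, Finset.sum_sub_distrib, hD, Finset.sum_const, hcardV]
    simp
    ring
  have hsymm : ∀ r d, F (r + d) d = F r d := fun r d => by simpa using hF.shift r d 1
  have hdir : ∀ s r, h r = -1 → F s (r - s) = 0 := by
    intro s r hr
    rw [← hsymm, add_sub_cancel]
    exact hneg0 r hr _
  -- A point of weight 2 is on just one line outside L. Points of weight -1 are on no line of L, so
  -- all of them lie among the two other points of that line.
  have htwo : ∀ s, h s = 2 → N.card ≤ 2 := by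
    intro s hs
    have h1 := hZ s
    rw [hs] at h1
    have h3 : (Finset.univ.filter fun d => F s d = 0).card = 3 := by omega
    have h4 : ((Finset.univ.filter fun d => F s d = 0).erase 0).card = 2 := by
      rw [Finset.card_erase_of_mem (by simp [hF.zero_dir]), h3]
    rw [← h4]
    refine Finset.card_le_card_of_injOn (fun r => r - s) ?_ (fun a _ b _ hab => by simpa using hab)
    intro r hr
    have hr' : h r = -1 := by simpa [hN] using hr
    simp only [Finset.coe_erase, Finset.coe_filter, Finset.mem_univ, true_and, Set.mem_sdiff,
      Set.mem_ofPred_eq, Set.mem_singleton_iff, hdir s r hr', sub_eq_zero]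
    rintro rfl
    omega
  have hpm : h p = -1 := by have := hlo p; omega
  have hpl : ∀ d, d ≠ 0 → h (p + d) + h (p - d) = 1 := by
    intro d hd
    have := hl p d hd
    rw [hneg0 p hpm] at this
    omega
  have hneg : ∀ r d, F r (-d) = F r d := fun r d => by
    simpa using hF.scale r d (-1) (neg_ne_zero.2 one_ne_zero)
  -- Around weight 1, ten nonzero vectors give lines of sum 0, each containing a point of weight -1,
  -- so there are at least five such points. The line joining two of them has a third point of
  -- weight 2, against `htwo`.
  have hno1 : ∀ r, h r ≠ 1 := by
    intro r hr
    have h1 := hZ r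
    rw [hr] at h1
    have h2 : ((Finset.univ.filter fun d => F r d = 0).erase 0).card = 10 := by
      rw [Finset.card_erase_of_mem (by simp [hF.zero_dir])]
      omega
    have hsub : (Finset.univ.filter fun d => F r d = 0).erase 0 ⊆
        N.image (fun a => a - r) ∪ N.image (fun a => r - a) := by
      intro d hd
      simp only [Finset.mem_erase, Finset.mem_filter, Finset.mem_univ, true_and] at hd
      have h3 := hl r d hd.1
      rw [hd.2, hr] at h3
      have h4 := hlo (r + d)
      have h5 := hlo (r - d)
      have h6 : h (r + d) = -1 ∨ h (r - d) = -1 := by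
        by_contra hcon
        push Not at hcon
        omega
      rw [Finset.mem_union, Finset.mem_image, Finset.mem_image]
      rcases h6 with h6 | h6
      · exact Or.inl ⟨r + d, by simp [hN, h6], by simp⟩
      · exact Or.inr ⟨r - d, by simp [hN, h6], by simp⟩
    have h3 := (Finset.card_le_card hsub).trans (Finset.card_union_le _ _)
    have h4 := Finset.card_image_le (s := N) (f := fun a => a - r)
    have h5 := Finset.card_image_le (s := N) (f := fun a => r - a)
    obtain ⟨p', hp', hne⟩ := Finset.exists_mem_ne (s := N) (by omega) p
    have h6 := hpl (p' - p) (sub_ne_zero.2 hne)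
    rw [add_sub_cancel, show h p' = -1 by simpa [hN] using hp'] at h6
    have := htwo (p - (p' - p)) (by omega)
    omega
  -- With weights only -1, 0, 2, a sum of 1 must be 2+(-1). This produces s here; applied to a line
  -- of L through s, it then puts a point of weight -1 on that line, a contradiction.
  obtain ⟨s, hs⟩ : ∃ s, h s = 2 := by
    have h1 := hpl 1 one_ne_zero
    have h2 := hno1 (p + 1)
    have h3 := hno1 (p - 1)
    have h4 := hlo (p + 1)
    have h5 := hlo (p - 1)
    have h6 := hhi (p + 1)
    have h7 := hhi (p - 1)
    by_cases h8 : h (p + 1) = 2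
    · exact ⟨_, h8⟩
    · exact ⟨p - 1, by omega⟩
  obtain ⟨d, hd⟩ : ∃ d, F s d ≠ 0 := by
    by_contra hcon
    push Not at hcon
    have := hD s
    simp [hcon, hs] at this
  have hd0 : d ≠ 0 := by rintro rfl; exact hd (hF.zero_dir s)
  have h1 := hl s d hd0
  rw [(hF.zero_or_one s d).resolve_left hd, hs] at h1
  have h2 := hno1 (s + d)
  have h3 := hno1 (s - d)
  have h4 := hlo (s + d)
  have h5 := hlo (s - d)
  have h6 := hhi (s + d)
  by_cases h7 : h (s + d) = -1
  · exact hd (by rw [← hsymm]; exact hneg0 _ h7 d)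
  · exact hd (by rw [← sub_add_cancel s d, hsymm]; exact hneg0 _ (by omega) d)

end LineFunction

end AG3
namespace AG3

/-! ### Lines, spreads and the flag function of a line class -/

section Lines

variable {K : Type*} [Field K]

/-- The line through `p` with direction vector `d` (a single point if `d = 0`). -/
def lineThrough (p d : AG3 K) : AffineSubspace K (AG3 K) :=
  AffineSubspace.mk' p (Submodule.span K {d})

lemma mem_lineThrough {p d r : AG3 K} : r ∈ lineThrough p d ↔ ∃ t : K, p + t • d = r := by
  simp only [lineThrough, AffineSubspace.mem_mk', Submodule.mem_span_singleton, vsub_eq_sub,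
    eq_sub_iff_add_eq']

lemma self_mem_lineThrough (p d : AG3 K) : p ∈ lineThrough p d :=
  AffineSubspace.self_mem_mk' _ _

lemma lineThrough_mem_lines (p : AG3 K) {d : AG3 K} (hd : d ≠ 0) : lineThrough p d ∈ lines K :=
  ⟨⟨p, self_mem_lineThrough p d⟩, by
    rw [lineThrough, AffineSubspace.direction_mk', finrank_span_singleton hd]⟩

lemma lineThrough_eq_of_mem {p d r : AG3 K} (hr : r ∈ lineThrough p d) :
    lineThrough r d = lineThrough p d := by
  have := AffineSubspace.mk'_eq hr
  rwa [lineThrough, AffineSubspace.direction_mk'] at this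

lemma lineThrough_add_smul (p d : AG3 K) (t : K) :
    lineThrough (p + t • d) d = lineThrough p d :=
  lineThrough_eq_of_mem (mem_lineThrough.2 ⟨t, rfl⟩)

lemma lineThrough_smul (p d : AG3 K) {s : K} (hs : s ≠ 0) :
    lineThrough p (s • d) = lineThrough p d := by
  rw [lineThrough, Submodule.span_singleton_smul_eq hs.isUnit, lineThrough]

lemma exists_eq_lineThrough {l : AffineSubspace K (AG3 K)} (hl : l ∈ lines K) {p : AG3 K}
    (hp : p ∈ l) : ∃ d, d ≠ 0 ∧ l = lineThrough p d := by
  obtain ⟨v, hv, hspan⟩ := finrank_eq_one_iff'.1 hl.2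
  refine ⟨v, by simpa using hv, ?_⟩
  refine (AffineSubspace.mk'_eq hp).symm.trans (congrArg (AffineSubspace.mk' p) ?_)
  ext w
  rw [Submodule.mem_span_singleton]
  constructor
  · intro hw
    obtain ⟨c, hc⟩ := hspan ⟨w, hw⟩
    exact ⟨c, congrArg Subtype.val hc⟩
  · rintro ⟨c, rfl⟩
    exact Submodule.smul_mem _ _ v.2

open Classical in
lemma card_points_of_mem_lines [Fintype K] {l : AffineSubspace K (AG3 K)} (hl : l ∈ lines K) :
    (Finset.univ.filter fun r => r ∈ l).card = Fintype.card K := by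
  obtain ⟨p, hp⟩ := hl.1
  obtain ⟨d, hd, rfl⟩ := exists_eq_lineThrough hl hp
  have : (Finset.univ.filter fun r => r ∈ lineThrough p d) =
      Finset.univ.image fun t : K => p + t • d := by
    ext r
    simp [mem_lineThrough]
  rw [this, Finset.card_image_of_injective _ fun s t hst =>
    smul_left_injective K hd (add_left_cancel hst), Finset.card_univ]

instance [Finite K] : Finite (AffineSubspace K (AG3 K)) :=
  Finite.of_injective _ (SetLike.coe_injective (A := AffineSubspace K (AG3 K)))

lemma IsLineSpread.eq_of_mem {S : Set (AffineSubspace K (AG3 K))} (hS : IsLineSpread S)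
    {l m : AffineSubspace K (AG3 K)} (hl : l ∈ S) (hm : m ∈ S) {r : AG3 K} (hrl : r ∈ l)
    (hrm : r ∈ m) : l = m := by
  by_contra hne
  exact Set.disjoint_left.1 (hS.1.2 l hl m hm hne) hrl hrm

open Classical in
/-- The points on the lines that a line spread shares with `L`, counted line by line. -/
lemma IsLineSpread.card_filter_mem [Fintype K] {S : Set (AffineSubspace K (AG3 K))}
    (hS : IsLineSpread S) (L : Set (AffineSubspace K (AG3 K)))
    {f : AG3 K → AffineSubspace K (AG3 K)} (hfS : ∀ r, f r ∈ S) (hf : ∀ r, r ∈ f r) :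
    (Finset.univ.filter fun r => f r ∈ L).card = Fintype.card K * (L ∩ S).ncard := by
  have hfin : (L ∩ S).Finite := Set.toFinite _
  have hmaps : ((Finset.univ.filter fun r => f r ∈ L : Finset (AG3 K)) : Set (AG3 K)).MapsTo f
      hfin.toFinset := by
    intro r hr
    simpa [hfS] using hr
  rw [Finset.card_eq_sum_card_fiberwise hmaps, Finset.sum_congr rfl
    (g := fun _ => Fintype.card K), Finset.sum_const, Set.ncard_eq_toFinset_card _ hfin,
    smul_eq_mul, mul_comm]
  intro l hl
  have hl' : l ∈ L ∧ l ∈ S := by simpa using hl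
  rw [← card_points_of_mem_lines (hS.1.1 hl'.2)]
  congr 1
  ext r
  simp only [Finset.mem_filter, Finset.mem_univ, true_and]
  constructor
  · rintro ⟨_, rfl⟩
    exact hf r
  · intro hr
    have := hS.eq_of_mem (hfS r) hl'.2 (hf r) hr
    exact ⟨this ▸ hl'.1, this⟩

lemma IsLineSpread.ncard_eq [Fintype K] {S : Set (AffineSubspace K (AG3 K))}
    (hS : IsLineSpread S) : S.ncard = Fintype.card K ^ 2 := by
  classical
  choose f hfS hf using hS.2
  have h := hS.card_filter_mem Set.univ hfS hf
  simp only [Set.mem_univ, Finset.filter_true, Finset.card_univ, Set.univ_inter,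
    Fintype.card_pi, Finset.prod_const, Fintype.card_fin] at h
  exact Nat.eq_of_mul_eq_mul_left Fintype.card_pos (h.symm.trans (by ring))

lemma IsLineSpread.ncard_inter_pointStar {S : Set (AffineSubspace K (AG3 K))}
    (hS : IsLineSpread S) (p : AG3 K) : (pointStar p ∩ S).ncard = 1 := by
  obtain ⟨l, hl, hp⟩ := hS.2 p
  rw [Set.ncard_eq_one]
  refine ⟨l, Set.eq_singleton_iff_unique_mem.2 ⟨⟨⟨hS.1.1 hl, hp⟩, hl⟩, ?_⟩⟩
  rintro m ⟨⟨_, hpm⟩, hm⟩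
  exact hS.eq_of_mem hm hl hpm hp

/-- A field of directions that is constant along its own lines gives a line spread. -/
lemma isLineSpread_range_lineThrough {δ : AG3 K → AG3 K} (h0 : ∀ r, δ r ≠ 0)
    (hδ : ∀ r (t : K), δ (r + t • δ r) = δ r) :
    IsLineSpread (Set.range fun r => lineThrough r (δ r)) := by
  have key : ∀ r u, u ∈ lineThrough r (δ r) → lineThrough u (δ u) = lineThrough r (δ r) := by
    intro r u hu
    obtain ⟨t, rfl⟩ := mem_lineThrough.1 hu
    rw [hδ, lineThrough_add_smul]
  refine ⟨⟨?_, ?_⟩, fun p => ⟨_, ⟨p, rfl⟩, self_mem_lineThrough _ _⟩⟩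
  · rintro _ ⟨r, rfl⟩
    exact lineThrough_mem_lines r (h0 r)
  · rintro _ ⟨r, rfl⟩ _ ⟨s, rfl⟩ hne
    rw [Set.disjoint_left]
    intro u hu hu'
    exact hne ((key r u hu).symm.trans (key s u hu'))

open Classical in
/-- The indicator function of `L` on flags. -/
noncomputable def flagIndicator (L : Set (AffineSubspace K (AG3 K))) (p d : AG3 K) : ℤ :=
  if d ≠ 0 ∧ lineThrough p d ∈ L then 1 else 0

lemma flagIndicator_eq_one {L : Set (AffineSubspace K (AG3 K))} {p d : AG3 K} (hd : d ≠ 0) :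
    flagIndicator L p d = 1 ↔ lineThrough p d ∈ L := by
  by_cases h : lineThrough p d ∈ L <;> simp [flagIndicator, hd, h]

lemma IsCLLineClassOfParameter.ncard_inter {x : ℕ} {L S : Set (AffineSubspace K (AG3 K))}
    (hL : IsCLLineClassOfParameter x L) (hS : IsLineSpread S) : (L ∩ S).ncard = x := by
  rw [Set.ncard, hL.2 S hS, ENat.toNat_natCast]

lemma IsCLLineClassOfParameter.sum_flagIndicator [Fintype K] {x : ℕ}
    {L : Set (AffineSubspace K (AG3 K))} (hL : IsCLLineClassOfParameter x L)
    {δ : AG3 K → AG3 K} (h0 : ∀ r, δ r ≠ 0) (hδ : ∀ r (t : K), δ (r + t • δ r) = δ r) :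
    ∑ r, flagIndicator L r (δ r) = Fintype.card K * x := by
  classical
  have hS := isLineSpread_range_lineThrough h0 hδ
  have h := hS.card_filter_mem L (f := fun r => lineThrough r (δ r)) (fun r => ⟨r, rfl⟩)
    (fun r => self_mem_lineThrough _ _)
  rw [hL.ncard_inter hS] at h
  rw [← Nat.cast_mul, ← h, Finset.card_filter]
  push_cast
  exact Finset.sum_congr rfl fun r _ => by simp [flagIndicator, h0]

/-- In a plane, the two parallel classes of lines can be switched within a line spread. -/
lemma IsCLLineClassOfParameter.sum_plane [Fintype K] {x : ℕ}
    {L : Set (AffineSubspace K (AG3 K))} (hL : IsCLLineClassOfParameter x L)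
    (p : AG3 K) {d e : AG3 K} (hde : LinearIndependent K ![d, e]) :
    ∑ u : K × K, flagIndicator L (p + u.1 • d + u.2 • e) d =
      ∑ u : K × K, flagIndicator L (p + u.1 • d + u.2 • e) e := by
  classical
  have hd : d ≠ 0 := hde.ne_zero 0
  have he : e ≠ 0 := hde.ne_zero 1
  set P : Finset (AG3 K) := Finset.univ.filter fun r => r - p ∈ Submodule.span K {d, e} with hP
  have hPd : ∀ r (t : K), r + t • d ∈ P ↔ r ∈ P := by
    intro r t
    have := (Submodule.span K {d, e}).smul_mem t
      (Submodule.subset_span (show d ∈ ({d, e} : Set (AG3 K)) by simp))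
    simp only [hP, Finset.mem_filter, Finset.mem_univ, true_and]
    rw [add_sub_right_comm, Submodule.add_mem_iff_left _ this]
  have hPe : ∀ r (t : K), r + t • e ∈ P ↔ r ∈ P := by
    intro r t
    have := (Submodule.span K {d, e}).smul_mem t
      (Submodule.subset_span (show e ∈ ({d, e} : Set (AG3 K)) by simp))
    simp only [hP, Finset.mem_filter, Finset.mem_univ, true_and]
    rw [add_sub_right_comm, Submodule.add_mem_iff_left _ this]
  have hsum : ∀ g : AG3 K → ℤ, ∑ r ∈ P, g r = ∑ u : K × K, g (p + u.1 • d + u.2 • e) := by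
    intro g
    have himg : P = Finset.univ.image fun u : K × K => p + u.1 • d + u.2 • e := by
      ext r
      simp only [hP, Finset.mem_filter, Finset.mem_univ, true_and, Submodule.mem_span_pair,
        Finset.mem_image, Prod.exists, eq_sub_iff_add_eq', add_assoc]
    rw [himg, Finset.sum_image]
    intro u _ v _ huv
    have h1 : (u.1 - v.1) • d + (u.2 - v.2) • e = 0 := by
      simp only at huv
      rw [add_assoc, add_assoc] at huv
      have := add_left_cancel huv
      rw [sub_smul, sub_smul, sub_add_sub_comm, this, sub_self]
    obtain ⟨h2, h3⟩ := LinearIndependent.pair_iff.1 hde _ _ h1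
    exact Prod.ext (sub_eq_zero.1 h2) (sub_eq_zero.1 h3)
  rw [← hsum fun r => flagIndicator L r d, ← hsum fun r => flagIndicator L r e]
  have h1 := hL.sum_flagIndicator (δ := fun _ => d) (fun _ => hd) (fun _ _ => rfl)
  -- Direction e inside the plane and d outside it is again a spread, since P is stable under both
  -- translations.
  have h2 := hL.sum_flagIndicator (δ := fun r => if r ∈ P then e else d)
    (fun r => by split_ifs <;> assumption)
    (fun r t => by
      by_cases hr : r ∈ P
      · simp [hr, hPe]
      · simp [hr, hPd])
  rw [← Finset.sum_add_sum_compl P] at h1 h2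
  have h3 : ∑ r ∈ P, flagIndicator L r (if r ∈ P then e else d) = ∑ r ∈ P, flagIndicator L r e :=
    Finset.sum_congr rfl fun r hr => by rw [if_pos hr]
  have h4 : ∑ r ∈ Pᶜ, flagIndicator L r (if r ∈ P then e else d) =
      ∑ r ∈ Pᶜ, flagIndicator L r d :=
    Finset.sum_congr rfl fun r hr => by rw [if_neg (Finset.mem_compl.1 hr)]
  linarith

lemma IsCLLineClassOfParameter.isBalanced [Fintype K] {x : ℕ}
    {L : Set (AffineSubspace K (AG3 K))} (hL : IsCLLineClassOfParameter x L) :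
    IsBalanced (flagIndicator L) x := by
  have hshift : ∀ p d (t : K), flagIndicator L (p + t • d) d = flagIndicator L p d :=
    fun p d t => by
      unfold flagIndicator
      congr 2
      rw [lineThrough_add_smul]
  have hscale : ∀ p d (s : K), s ≠ 0 → flagIndicator L p (s • d) = flagIndicator L p d :=
    fun p d s hs => by
      unfold flagIndicator
      congr 1
      rw [lineThrough_smul p d hs]
      simp [hs]
  refine ⟨fun p d => ?_, fun p => by simp [flagIndicator], hshift, hscale, fun p d e hd he => ?_,
    fun d hd => hL.sum_flagIndicator (fun _ => hd) (fun _ _ => rfl)⟩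
  · unfold flagIndicator
    split_ifs <;> simp
  · by_cases hde : LinearIndependent K ![d, e]
    · have h := hL.sum_plane p hde
      rw [Fintype.sum_prod_type_right, Fintype.sum_prod_type] at h
      simp only [hshift, add_right_comm p _ (_ • e), Finset.sum_const, Finset.card_univ,
        ← Finset.smul_sum] at h
      simp only [add_right_comm p _ (_ • d), hshift, Finset.sum_const, Finset.card_univ,
        ← Finset.smul_sum] at h
      exact (smul_right_injective ℤ (Fintype.card_ne_zero (α := K)) h).symm
    -- Parallel directions: every term on either side is the flag of the same line.
    · rw [LinearIndependent.pair_iff' hd] at hde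
      push Not at hde
      obtain ⟨s, rfl⟩ := hde
      have hs : s ≠ 0 := by rintro rfl; simp at he
      simp only [hscale _ _ _ hs, smul_smul, hshift]

/-- Cameron–Liebler line classes of small parameter. -/
lemma IsCLLineClassOfParameter.eq_empty_or_pointStar [Fintype K]
    (hK : Fintype.card K = 2 ∨ Fintype.card K = 3) {x : ℕ}
    (hx : 2 * x ≤ Fintype.card K ^ 2) {L : Set (AffineSubspace K (AG3 K))}
    (hL : IsCLLineClassOfParameter x L) : L = ∅ ∨ ∃ c, L = pointStar c := by
  classical
  have hF := hL.isBalanced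
  obtain ⟨h, hdeg, hline⟩ := hF.exists_weight
  have hpos : ∀ p, 0 ≤ h p := by
    rcases hK with hK | hK
    -- For q=2, 3h+x ≥ 0 with x ≤ 2 already forces h ≥ 0.
    · intro p
      have h1 := Finset.sum_nonneg fun e (_ : e ∈ Finset.univ) => hF.nonneg p e
      rw [hdeg, hK] at h1
      rw [hK] at hx
      push_cast at h1
      omega
    · exact hF.weight_nonneg_of_card_eq_three hK (by rw [hK] at hx; omega) hdeg hline
  have hx' : (x : ℤ) ≤ Fintype.card K + 1 := by
    rcases hK with hK | hK <;> rw [hK] at hx ⊢ <;> push_cast <;> omega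
  rcases hF.eq_zero_or_star hx' hdeg hline hpos with h0 | ⟨c, hc⟩
  · left
    refine Set.eq_empty_iff_forall_notMem.2 fun l hl => ?_
    obtain ⟨p, hp⟩ := (hL.1 hl).1
    obtain ⟨d, hd, rfl⟩ := exists_eq_lineThrough (hL.1 hl) hp
    have := (flagIndicator_eq_one hd).2 hl
    rw [h0] at this
    exact zero_ne_one this
  · right
    refine ⟨c, Set.ext fun l => ?_⟩
    by_cases hl : l ∈ lines K
    · obtain ⟨p, hp⟩ := hl.1
      obtain ⟨d, hd, rfl⟩ := exists_eq_lineThrough hl hp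
      rw [← flagIndicator_eq_one hd, hc p d hd, ← mem_lineThrough]
      exact ⟨fun h => ⟨hl, h⟩, fun h => h.2⟩
    · exact ⟨fun h => absurd (hL.1 h) hl, fun h => absurd h.1 hl⟩

/-! ### The trivial examples and complementation -/

lemma isCLLineClassOfParameter_of_ncard [Finite K] {x : ℕ} {L : Set (AffineSubspace K (AG3 K))}
    (hL : L ⊆ lines K) (h : ∀ S, IsLineSpread S → (L ∩ S).ncard = x) :
    IsCLLineClassOfParameter x L :=
  ⟨hL, fun S hS => by rw [← h S hS, (Set.toFinite (L ∩ S)).cast_ncard_eq]⟩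

lemma pointStar_subset_lines (p : AG3 K) : pointStar p ⊆ lines K := fun _ h => h.1

lemma isCLLineClassOfParameter_pointStar [Finite K] (p : AG3 K) :
    IsCLLineClassOfParameter 1 (pointStar p) :=
  isCLLineClassOfParameter_of_ncard (pointStar_subset_lines p)
    fun _ hS => hS.ncard_inter_pointStar p

lemma isCLLineClassOfParameter_empty [Finite K] :
    IsCLLineClassOfParameter 0 (∅ : Set (AffineSubspace K (AG3 K))) :=
  isCLLineClassOfParameter_of_ncard (Set.empty_subset _) (by simp)

lemma IsCLLineClassOfParameter.compl [Fintype K] {x : ℕ} {L : Set (AffineSubspace K (AG3 K))}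
    (hL : IsCLLineClassOfParameter x L) :
    IsCLLineClassOfParameter (Fintype.card K ^ 2 - x) (lines K \ L) := by
  refine isCLLineClassOfParameter_of_ncard Set.sdiff_subset fun S hS => ?_
  have h1 : (lines K \ L) ∩ S = S \ (L ∩ S) := by
    ext l
    have := @hS.1.1 l
    simp only [Set.mem_inter_iff, Set.mem_sdiff]
    tauto
  rw [h1, Set.ncard_sdiff Set.inter_subset_right, hS.ncard_eq, hL.ncard_inter hS]

end Lines

end AG3

theorem theorem6p2 {K : Type*} [Field K] [Finite K] (q : ℕ) (hq : q = 2 ∨ q = 3)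
    (hK : Nat.card K = q) (L : Set (AffineSubspace K (AG3 K))) :
    AG3.IsCLLineClass L ↔ AG3.IsTrivialLineClass L := by
  have := Fintype.ofFinite K
  rw [Nat.card_eq_fintype_card] at hK
  rw [← hK] at hq
  constructor
  · rintro ⟨x, hL⟩
    by_cases hx : 2 * x ≤ Fintype.card K ^ 2
    · rcases hL.eq_empty_or_pointStar hq hx with h | h
      · exact Or.inl h
      · exact Or.inr (Or.inl h)
    · have hcompl : L = AG3.lines K \ (AG3.lines K \ L) :=
        (Set.sdiff_sdiff_cancel_left hL.1).symm
      rcases hL.compl.eq_empty_or_pointStar hq (by omega) with h | ⟨c, h⟩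
      · rw [h, Set.sdiff_empty] at hcompl
        exact Or.inr (Or.inr (Or.inr hcompl))
      · rw [h] at hcompl
        exact Or.inr (Or.inr (Or.inl ⟨c, hcompl⟩))
  · rintro (rfl | ⟨p, rfl⟩ | ⟨p, rfl⟩ | rfl)
    · exact ⟨_, AG3.isCLLineClassOfParameter_empty⟩
    · exact ⟨_, AG3.isCLLineClassOfParameter_pointStar p⟩
    · exact ⟨_, (AG3.isCLLineClassOfParameter_pointStar p).compl⟩
    · have := (AG3.isCLLineClassOfParameter_empty (K := K)).compl
      rw [Set.sdiff_empty] at this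
      exact ⟨_, this⟩
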